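/- Let $\Omega$ be a locally compact Hausdorff space, $\mathcal U$ a separable real Hilbert space, and let $\mathcal M(\Omega;\mathcal U)$ be the Banach space of regular Borel measures $u$ on $\Omega$ with values in $\mathcal U$ whose total variation measure $|u|$ is finite, with norm $\|u\|_{\mathcal M}=|u|(\Omega)$. It is paired with $C_0(\Omega;\mathcal U)$, the space of continuous functions vanishing at infinity, by $\langle \varphi,u\rangle=\int_\Omega\langle u'(\omega),\varphi(\omega)\rangle_{\mathcal U}\,d|u|(\omega)$, where $u'$ is the Radon–Nikodym derivative of $u$ with respect to $|u|$. Let $T>0$, $L\in\mathbb N$, $1<p\le\infty$ and $\frac1p+\frac1q=1$. Let $B\colon\mathcal M(\Omega;\mathcal U)\to L^p(0,T;\mathbb R^L)$ be a bounded real-linear operator that has a bounded real-linear predual operator $B^*\colon L^q(0,T;\mathbb R^L)\to C_0(\Omega;\mathcal U)$, that is, $\langle B^*f,u\rangle=\int_0^T f(t)\cdot (Bu)(t)\,dt$ for all $f\in L^q(0,T;\mathbb R^L)$ and $u\in\mathcal M(\Omega;\mathcal U)$. Let $\mathcal H$ be a complex Hilbert space, $H_0$ a (possibly unbounded) self-adjoint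 operator on $\mathcal H$, $H_1,\dots,H_L$ bounded self-adjoint operators on $\mathcal H$, $\psi_0\in\mathcal H$, $\mathcal O$ a bounded real-linear operator on $\mathcal H$, and $\alpha>0$. For $u\in\mathcal M(\Omega;\mathcal U)$ let $\psi_u\in C([0,T];\mathcal H)$ be the mild solution of $i\partial_t\psi=\big(H_0+\sum_{l=1}^L (Bu)_l(t)H_l\big)\psi$, $\psi(0)=\psi_0$, that is, the unique solution of $$\psi_u(t)=e^{-itH_0}\psi_0+\int_0^t e^{-i(t-s)H_0}\sum_{l=1}^L (Bu)_l(s)\,(-iH_l)\,\psi_u(s)\,ds ,\qquad t\in[0,T],$$ and let $$j(u)=\tfrac12\operatorname{Re}\langle\psi_u(T),\mathcal O\psi_u(T)\rangle_{\mathcal H}+\alpha\|u\|_{\mathcal M}.$$ If $\bar u\in\mathcal M(\Omega;\mathcal U)$ is a local minimizer of $j$ with respect to the norm of $\mathcal M(\Omega;\mathcal U)$ (in particular, if it is a global minimizer), then the support $\operatorname{supp}|\bar u|$ is a compact subset of $\Omega$, even when $\Omega$ is not compact. -/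

import Mathlib

open MeasureTheory
open scoped ENNReal

noncomputable section

namespace QuantumControl

/-! ### The space `𝓜(Ω; 𝓤)` of regular vector measures of finite mass -/

section FiniteMass

variable {Ω : Type*} [TopologicalSpace Ω] [T2Space Ω] [MeasurableSpace Ω] [BorelSpace Ω]
variable {U : Type*} [NormedAddCommGroup U] [InnerProductSpace ℝ U]

/-- On a Hausdorff space, a measure dominated by a finite regular Borel measure is regular. -/
theorem regular_of_le {μ ν : Measure Ω} [IsFiniteMeasure μ] [μ.Regular] (h : ν ≤ μ) :
    ν.Regular := by
  have hν : IsFiniteMeasure ν := isFiniteMeasure_of_le μ h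
  have inner : ν.InnerRegular := by
    constructor
    intro A hA r hr
    have hpos : ν A - r ≠ 0 := (tsub_pos_of_lt hr).ne'
    obtain ⟨K, hKA, hK, hlt⟩ := hA.exists_isCompact_sdiff_lt (μ := μ) (measure_ne_top μ A) hpos
    refine ⟨K, hKA, hK, ?_⟩
    have h1 : ν A ≤ ν K + ν (A \ K) := by
      calc ν A = ν (K ∪ A \ K) := by rw [Set.union_sdiff_cancel hKA]
        _ ≤ _ := measure_union_le _ _
    have h2 : ν A < ν K + (ν A - r) :=
      h1.trans_lt (ENNReal.add_lt_add_left (measure_ne_top ν K) ((h _).trans_lt hlt))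
    by_contra hle
    have h3 : ν K + (ν A - r) ≤ ν A := by
      calc ν K + (ν A - r) ≤ r + (ν A - r) := by gcongr; exact not_lt.mp hle
        _ = ν A := add_tsub_cancel_of_le hr.le
    exact absurd h2 (not_lt.mpr h3)
  infer_instance

/-- On a Hausdorff space, a sum of two finite regular Borel measures is regular. -/
theorem regular_add {μ ν : Measure Ω} [IsFiniteMeasure μ] [IsFiniteMeasure ν]
    [μ.Regular] [ν.Regular] : (μ + ν).Regular := by
  have : (μ + ν).InnerRegular := inferInstance
  infer_instance

variable (Ω U)

/-- The space `𝓜(Ω; 𝓤)`: countably additive Borel measures `u` on `Ω` with values in `𝓤` whose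
total variation measure `|u|` is finite and regular. (On a second countable locally compact
Hausdorff space the regularity holds automatically.) -/
def finiteMassMeasures : Submodule ℝ (VectorMeasure Ω U) where
  carrier := {u | IsFiniteMeasure u.variation ∧ u.variation.Regular}
  zero_mem' := by
    simp only [Set.mem_ofPred_eq, VectorMeasure.variation_zero]
    exact ⟨inferInstance, inferInstance⟩
  add_mem' := by
    rintro u v ⟨hu, hu'⟩ ⟨hv, hv'⟩
    have := regular_add (μ := u.variation) (ν := v.variation)
    have hle : (u + v).variation ≤ u.variation + v.variation := VectorMeasure.variation_add_le
    exact ⟨isFiniteMeasure_of_le _ hle, regular_of_le hle⟩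
  smul_mem' := by
    rintro c u ⟨hu, hu'⟩
    have h : (c • u).variation = ‖c‖₊ • u.variation := VectorMeasure.variation_smul
    simp only [Set.mem_ofPred_eq, h]
    exact ⟨inferInstance, inferInstance⟩

/-- The type `𝓜(Ω; 𝓤)`. -/
abbrev FiniteMassMeasure : Type _ := finiteMassMeasures Ω U

variable {Ω U}

/-- The total variation measure `|u|`. -/
abbrev FiniteMassMeasure.totalVariation (u : FiniteMassMeasure Ω U) : Measure Ω :=
  (u : VectorMeasure Ω U).variation

instance (u : FiniteMassMeasure Ω U) : IsFiniteMeasure u.totalVariation := u.2.1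

/-- The mass norm `‖u‖ = |u|(Ω)`. -/
instance : Norm (FiniteMassMeasure Ω U) where
  norm u := u.totalVariation.real Set.univ

theorem FiniteMassMeasure.norm_def (u : FiniteMassMeasure Ω U) :
    ‖u‖ = u.totalVariation.real Set.univ := rfl

theorem FiniteMassMeasure.normCore : NormedSpace.Core ℝ (FiniteMassMeasure Ω U) where
  norm_nonneg _ := measureReal_nonneg
  norm_smul c u := by
    have h : (c • (u : VectorMeasure Ω U)).variation
        = ‖c‖₊ • (u : VectorMeasure Ω U).variation := VectorMeasure.variation_smul
    rw [FiniteMassMeasure.norm_def, FiniteMassMeasure.norm_def,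
      FiniteMassMeasure.totalVariation, Submodule.coe_smul, h]
    simp [Measure.real]
  norm_triangle u v := by
    have h : ((u : VectorMeasure Ω U) + v).variation ≤ u.totalVariation + v.totalVariation :=
      VectorMeasure.variation_add_le
    simp only [FiniteMassMeasure.norm_def]
    rw [← measureReal_add_apply]
    exact ENNReal.toReal_mono (measure_ne_top _ _) (h _)
  norm_eq_zero_iff u := by
    rw [FiniteMassMeasure.norm_def, measureReal_eq_zero_iff, Measure.measure_univ_eq_zero,
      VectorMeasure.variation_eq_zero, Submodule.coe_eq_zero]

instance : NormedAddCommGroup (FiniteMassMeasure Ω U) :=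
  NormedAddCommGroup.ofCore FiniteMassMeasure.normCore

instance : NormedSpace ℝ (FiniteMassMeasure Ω U) :=
  NormedSpace.ofCore FiniteMassMeasure.normCore

/-- The pairing `⟨φ, u⟩ = ∫ ⟨φ, du⟩` of `C₀(Ω; 𝓤)` with `𝓜(Ω; 𝓤)`: the integral of `φ` against the
vector measure `u` with respect to the inner product of `𝓤`. If `u'` is the Radon-Nikodym
derivative of `u` with respect to `|u|`, this is `∫ ⟨u'(ω), φ(ω)⟩ d|u|(ω)`. -/
def pairing (φ : ZeroAtInftyContinuousMap Ω U) (u : FiniteMassMeasure Ω U) : ℝ :=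
  (u : VectorMeasure Ω U).integral φ (innerSL ℝ)

end FiniteMass

/-! ### Fields -/

/-- Lebesgue measure on the time interval `(0, T]` (equivalently, up to a null set, `(0, T)`). -/
abbrev timeMeasure (T : ℝ) : Measure ℝ := volume.restrict (Set.Ioc 0 T)

/-- The space `L^p(0, T; ℝ^L)` of control fields. -/
abbrev FieldSpace (L : ℕ) (p : ℝ≥0∞) (T : ℝ) : Type :=
  Lp (EuclideanSpace ℝ (Fin L)) p (timeMeasure T)

/-- `Bstar` is a predual operator of `B`: `⟨Bstar f, u⟩ = ⟨f, B u⟩` for all `f ∈ L^q(0, T; ℝ^L)` and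
`u ∈ 𝓜(Ω; 𝓤)`. -/
def IsPredual {Ω : Type*} [TopologicalSpace Ω] [T2Space Ω] [MeasurableSpace Ω] [BorelSpace Ω]
    {U : Type*} [NormedAddCommGroup U] [InnerProductSpace ℝ U]
    {L : ℕ} {p q : ℝ≥0∞} {T : ℝ} [Fact (1 ≤ p)] [Fact (1 ≤ q)]
    (Bstar : FieldSpace L q T →L[ℝ] ZeroAtInftyContinuousMap Ω U)
    (B : FiniteMassMeasure Ω U →L[ℝ] FieldSpace L p T) : Prop :=
  ∀ (f : FieldSpace L q T) (u : FiniteMassMeasure Ω U),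
    pairing (Bstar f) u = ∫ t, inner ℝ (f t) (B u t) ∂(timeMeasure T)

/-! ### Controlled quantum dynamics -/

section Dynamics

variable {H : Type*} [NormedAddCommGroup H] [InnerProductSpace ℂ H]

/-- `G` is the strongly continuous one-parameter unitary group with infinitesimal generator
`-i H₀`, i.e. `G(t) = exp(-i t H₀)`: the orbit of `x` is differentiable at `0` with derivative `y`
exactly when `x ∈ D(H₀)` and `y = -i H₀ x`. -/
structure IsUnitaryGroupGeneratedBy (H₀ : H →ₗ.[ℂ] H) (G : ℝ → (H ≃ₗᵢ[ℂ] H)) : Prop where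
  map_zero : G 0 = 1
  map_add : ∀ s t, G (s + t) = G s * G t
  continuous : ∀ x, Continuous fun t => G t x
  generator : ∀ x y, HasDerivAt (fun t => G t x) y 0 ↔
    ∃ hx : x ∈ H₀.domain, y = -Complex.I • H₀ ⟨x, hx⟩

open Classical in
/-- The unitary group `G(t) = exp(-i t H₀)` of a self-adjoint operator `H₀`. Such a group exists by
Stone's theorem and is unique; the trivial group is a dummy value for the other operators. -/
def unitaryGroup (H₀ : H →ₗ.[ℂ] H) : ℝ → (H ≃ₗᵢ[ℂ] H) :=
  if h : ∃ G, IsUnitaryGroupGeneratedBy H₀ G then h.choose else fun _ => 1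

/-- `ψ ∈ C([0, T]; H)` is a mild solution of
`i ∂ₜ ψ = (H₀ + ∑ₗ vₗ(t) Hₗ) ψ`, `ψ(0) = ψ₀`, that is
`ψ(t) = G(t) ψ₀ + ∫₀ᵗ G(t - s) ∑ₗ vₗ(s) (-i Hₗ) ψ(s) ds` on `[0, T]`. -/
def IsMildSolution {L : ℕ} (T : ℝ) (H₀ : H →ₗ.[ℂ] H) (Hc : Fin L → H →L[ℂ] H) (ψ₀ : H)
    (v : ℝ → EuclideanSpace ℝ (Fin L)) (ψ : ℝ → H) : Prop :=
  ContinuousOn ψ (Set.Icc 0 T) ∧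
    ∀ t ∈ Set.Icc 0 T, ψ t = unitaryGroup H₀ t ψ₀ +
      ∫ s in (0 : ℝ)..t, unitaryGroup H₀ (t - s) (∑ l, v s l • (-Complex.I • Hc l (ψ s)))

open Classical in
/-- The mild solution `ψ` for the control field `v` (it exists and is unique on `[0, T]` for every
integrable field; zero is a dummy value for the other fields). -/
def stateOf {L : ℕ} (T : ℝ) (H₀ : H →ₗ.[ℂ] H) (Hc : Fin L → H →L[ℂ] H) (ψ₀ : H)
    (v : ℝ → EuclideanSpace ℝ (Fin L)) : ℝ → H :=
  if h : ∃ ψ, IsMildSolution T H₀ Hc ψ₀ v ψ then h.choose else 0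

/-- The cost `J(ψ, u) = ½ ⟨ψ(T), O ψ(T)⟩ + α ‖u‖`, with the real scalar product of `H`. -/
def cost {Ω : Type*} [TopologicalSpace Ω] [T2Space Ω] [MeasurableSpace Ω] [BorelSpace Ω]
    {U : Type*} [NormedAddCommGroup U] [InnerProductSpace ℝ U]
    (T : ℝ) (O : H →L[ℝ] H) (α : ℝ) (ψ : ℝ → H) (u : FiniteMassMeasure Ω U) : ℝ :=
  1 / 2 * (inner ℂ (ψ T) (O (ψ T))).re + α * ‖u‖

/-- The reduced cost `j(u) = J(ψ(u), u)`, where `ψ(u)` is the state for the control field `B u`. -/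
def reducedCost {Ω : Type*} [TopologicalSpace Ω] [T2Space Ω] [MeasurableSpace Ω] [BorelSpace Ω]
    {U : Type*} [NormedAddCommGroup U] [InnerProductSpace ℝ U]
    {L : ℕ} {p : ℝ≥0∞} [Fact (1 ≤ p)] (T : ℝ) (H₀ : H →ₗ.[ℂ] H) (Hc : Fin L → H →L[ℂ] H) (ψ₀ : H)
    (O : H →L[ℝ] H) (α : ℝ) (B : FiniteMassMeasure Ω U →L[ℝ] FieldSpace L p T)
    (u : FiniteMassMeasure Ω U) : ℝ :=
  cost T O α (stateOf T H₀ Hc ψ₀ (B u)) u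

end Dynamics

end QuantumControl

end

namespace QuantumControl

open Set Filter Topology
open scoped RealInnerProductSpace

/-! ### Product rule for inner products of absolutely continuous curves -/

section InnerProduct

variable {E : Type*} [NormedAddCommGroup E] [InnerProductSpace ℝ E]

/-! The minimizer `u` is tested only against its own partial shrinkings `u - ε • u|_A`, with `A`
measurable and `0 < ε < 1`. Such a step lowers the mass by at least `ε |u|(A)`, while the observable
changes by `-ε` times a linear term plus `O(ε²)`. If `g` is the gradient of `⟨ψ(T), O ψ(T)⟩` with
respect to the field and `φ = B*(g/2)`, local minimality gives `α |u|(A) ≤ -⟨φ, u|_A⟩ ≤ ∫_A ‖φ‖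
d|u|` for every `A` (`exists_mul_totalVariation_le`). With `A = {‖φ‖ < α}` this forces `|u|(A) = 0`.
Since `A` is open, the support lies in `{‖φ‖ ≥ α}`, which is contained in a compact set because `φ`
vanishes at infinity (`isCompact_support_of_forall_mul_le`). Neither the subdifferential of the norm
nor the density `u'` is needed.

The analytic work is the existence of `g` (`exists_gradient`, `exists_observable_gradient`). The
interaction picture `x(t) = exp(itH₀) ψ(t)` removes the unbounded operator: `x` solves `x' = ∑ vₗ
Dₗ(t) x` with bounded, strongly continuous, skew-adjoint `Dₗ(t)`. Skewness makes energy estimates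
work without Gronwall, and makes the adjoint equation coincide with the state equation, solved from
a terminal value. The adjoint state `χ` yields `gₗ(s) = ⟨χ(s), Dₗ(s) x(s)⟩`. This is continuous on
`[0, T]`, so it lies in every `L^q` and `B*` can be applied to it. -/

theorem absolutelyContinuousOnInterval_inner {f g : ℝ → E} {a b : ℝ}
    (hf : AbsolutelyContinuousOnInterval f a b) (hg : AbsolutelyContinuousOnInterval g a b) :
    AbsolutelyContinuousOnInterval (fun t => ⟪f t, g t⟫) a b := by
  obtain ⟨C, hC⟩ := hf.exists_bound
  obtain ⟨D, hD⟩ := hg.exists_bound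
  unfold AbsolutelyContinuousOnInterval at hf hg
  apply squeeze_zero' ?_ ?_
    (by simpa using (hg.const_mul C).add (hf.const_mul D))
  · exact Eventually.of_forall fun _ => Finset.sum_nonneg fun i _ => dist_nonneg
  rw [eventually_inf_principal]
  filter_upwards with (n, I) hnI
  simp only [Finset.mul_sum, ← Finset.sum_add_distrib]
  gcongr with i hi
  trans dist ⟪f (I i).1, g (I i).1⟫ ⟪f (I i).1, g (I i).2⟫ +
      dist ⟪f (I i).1, g (I i).2⟫ ⟪f (I i).2, g (I i).2⟫
  · exact dist_triangle _ _ _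
  · simp only [dist_eq_norm, ← inner_sub_left, ← inner_sub_right]
    gcongr
    · exact (norm_inner_le_norm _ _).trans
        (mul_le_mul_of_nonneg_right (hC _ (hnI.left i hi |>.left)) (norm_nonneg _))
    · refine (norm_inner_le_norm _ _).trans ?_
      rw [mul_comm]
      exact mul_le_mul_of_nonneg_right (hD _ (hnI.left i hi |>.right)) (norm_nonneg _)

theorem absolutelyContinuousOnInterval_of_dist_le {X : Type*} [PseudoMetricSpace X]
    {f : ℝ → X} {φ : ℝ → ℝ} {a b : ℝ}
    (hφ : AbsolutelyContinuousOnInterval φ a b)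
    (h : ∀ s ∈ uIcc a b, ∀ t ∈ uIcc a b, dist (f s) (f t) ≤ dist (φ s) (φ t)) :
    AbsolutelyContinuousOnInterval f a b := by
  refine squeeze_zero' (Eventually.of_forall fun _ => Finset.sum_nonneg fun _ _ => dist_nonneg)
    ?_ hφ
  rw [eventually_inf_principal]
  filter_upwards with (n, I) hnI
  exact Finset.sum_le_sum fun i hi => h _ (hnI.left i hi).1 _ (hnI.left i hi).2

/-- The increments are dominated by those of the real primitive `∫ ‖F‖`, which is absolutely
continuous. -/
theorem absolutelyContinuousOnInterval_primitive {F : ℝ → E} {a b : ℝ} (f₀ : E)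
    (hF : IntervalIntegrable F volume a b) :
    AbsolutelyContinuousOnInterval (fun t => f₀ + ∫ s in a..t, F s) a b := by
  refine absolutelyContinuousOnInterval_of_dist_le
    (hF.norm.absolutelyContinuousOnInterval_intervalIntegral (c := a) (by simp)) ?_
  intro s hs t ht
  have hint : ∀ r ∈ uIcc a b, IntervalIntegrable F volume a r := fun r hr =>
    hF.mono_set (uIcc_subset_uIcc_left hr)
  rw [dist_add_left, dist_eq_norm, Real.dist_eq,
    intervalIntegral.integral_interval_sub_left (hint s hs) (hint t ht),
    intervalIntegral.integral_interval_sub_left (hint s hs).norm (hint t ht).norm]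
  exact intervalIntegral.norm_integral_le_abs_integral_norm

/-- The product rule for the inner product of two primitives of integrable functions. -/
theorem inner_primitive_eq_add_integral [CompleteSpace E] {F G : ℝ → E} {a b : ℝ} (f₀ g₀ : E)
    (hF : IntervalIntegrable F volume a b) (hG : IntervalIntegrable G volume a b) :
    ⟪f₀ + ∫ s in a..b, F s, g₀ + ∫ s in a..b, G s⟫ = ⟪f₀, g₀⟫ +
      ∫ t in a..b, (⟪f₀ + ∫ s in a..t, F s, G t⟫ + ⟪F t, g₀ + ∫ s in a..t, G s⟫) := by
  have key := (absolutelyContinuousOnInterval_inner (absolutelyContinuousOnInterval_primitive f₀ hF)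
    (absolutelyContinuousOnInterval_primitive g₀ hG)).integral_deriv_eq_sub
  simp only [intervalIntegral.integral_same, add_zero] at key
  rw [← sub_eq_iff_eq_add', ← key]
  apply intervalIntegral.integral_congr_ae
  filter_upwards [hF.ae_hasDerivAt_integral, hG.ae_hasDerivAt_integral] with t h1 h2 ht
  have ht' := uIoc_subset_uIcc ht
  exact (((h1 ht' a (by simp)).const_add f₀).inner ℝ ((h2 ht' a (by simp)).const_add g₀)).deriv

end InnerProduct

/-! ### Linear Volterra equations with integrable kernels -/

section Volterra

/-- Since `a` is only integrable, it is split into a bounded continuous `g` and a remainder of `L¹`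
norm at most `1/4`. The weight is at most `1` on the remainder, and its integral is at most `1/c`,
which handles `g`. The lemma supplies the contraction constant in the Picard iteration. -/
theorem exists_exponential_weight {a : ℝ → ℝ} {T : ℝ} (hT : 0 ≤ T)
    (ha : IntervalIntegrable a volume 0 T) :
    ∃ c : ℝ, ∀ t ∈ Icc 0 T, ∫ s in (0 : ℝ)..t, Real.exp (-(c * (t - s))) * a s ≤ 1 / 2 := by
  have ha' : Integrable a (volume.restrict (Ioc 0 T)) :=
    (intervalIntegrable_iff_integrableOn_Ioc_of_le hT).1 ha
  obtain ⟨g, hg, hgi⟩ := ha'.exists_boundedContinuous_integral_sub_le (ε := 1 / 4) (by norm_num)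
  have hdiff : IntervalIntegrable (fun s => ‖a s - g s‖) volume 0 T :=
    (intervalIntegrable_iff_integrableOn_Ioc_of_le hT).2 (ha'.sub hgi).norm
  -- Chosen so that `‖g‖ / c ≤ 1/4`; the `+ 1` keeps `c` positive when `g = 0`.
  set c : ℝ := 4 * ‖g‖ + 1
  have hc : 0 < c := by positivity
  refine ⟨c, fun t ht => ?_⟩
  have hsub : uIcc 0 t ⊆ uIcc 0 T := by
    rw [uIcc_of_le ht.1, uIcc_of_le hT]; exact Icc_subset_Icc_right ht.2
  have hexp : Continuous fun s => Real.exp (-(c * (t - s))) := by fun_prop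
  have hd : ∀ s, HasDerivAt (fun s => Real.exp (-(c * (t - s))) / c)
      (Real.exp (-(c * (t - s)))) s := fun s => by
    have h : HasDerivAt (fun s => -(c * (t - s))) c s := by
      simpa using (((hasDerivAt_id s).const_sub t).const_mul c).fun_neg
    simpa [hc.ne'] using h.exp.div_const c
  have hI : ∫ s in (0 : ℝ)..t, Real.exp (-(c * (t - s))) ≤ 1 / c := by
    rw [intervalIntegral.integral_eq_sub_of_hasDerivAt (fun s _ => hd s)
      (hexp.intervalIntegrable _ _)]
    have : 0 ≤ Real.exp (-(c * (t - 0))) / c := by positivity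
    simpa using this
  calc ∫ s in (0 : ℝ)..t, Real.exp (-(c * (t - s))) * a s
      ≤ ∫ s in (0 : ℝ)..t, (‖a s - g s‖ + ‖g‖ * Real.exp (-(c * (t - s)))) := by
        refine intervalIntegral.integral_mono_on ht.1
          ((ha.mono_set hsub).continuousOn_mul hexp.continuousOn)
          ((hdiff.mono_set hsub).add ((continuous_const.mul hexp).intervalIntegrable _ _))
          fun s hs => ?_
        have h1 : Real.exp (-(c * (t - s))) ≤ 1 :=
          Real.exp_le_one_iff.2 (neg_nonpos.2 (mul_nonneg hc.le (sub_nonneg.2 hs.2)))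
        have h2 : a s ≤ ‖a s - g s‖ + ‖g‖ := by
          have h3 := le_abs_self (a s - g s)
          have h4 := (le_abs_self (g s)).trans (g.norm_coe_le_norm s)
          rw [Real.norm_eq_abs]; linarith
        have h0 := Real.exp_pos (-(c * (t - s)))
        nlinarith [norm_nonneg (a s - g s), norm_nonneg g]
    _ = (∫ s in (0 : ℝ)..t, ‖a s - g s‖) + ‖g‖ * ∫ s in (0 : ℝ)..t, Real.exp (-(c * (t - s))) := by
        rw [intervalIntegral.integral_add (hdiff.mono_set hsub)
          ((hexp.intervalIntegrable _ _).const_mul _),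
          intervalIntegral.integral_const_mul]
    _ ≤ 1 / 4 + ‖g‖ * (1 / c) := by
        gcongr
        refine le_trans ?_ hg
        rw [← intervalIntegral.integral_of_le hT]
        exact intervalIntegral.integral_mono_interval le_rfl ht.1 ht.2
          (Eventually.of_forall fun _ => norm_nonneg _) hdiff
    _ ≤ 1 / 2 := by
        have : ‖g‖ * (1 / c) ≤ 1 / 4 := by
          rw [mul_one_div, div_le_iff₀ hc]; simp only [c]; linarith
        linarith

/-- Linear Volterra equations with an integrable kernel are solvable. -/
theorem exists_volterra_solution {E : Type*} [NormedAddCommGroup E] [NormedSpace ℝ E]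
    [CompleteSpace E] {T : ℝ} (hT : 0 ≤ T) {A : ℝ → E →L[ℝ] E} {a : ℝ → ℝ}
    (ha : IntervalIntegrable a volume 0 T) (hAa : ∀ s, ‖A s‖ ≤ a s)
    (hA : ∀ x : ℝ → E, Continuous x → IntervalIntegrable (fun s => A s (x s)) volume 0 T)
    (x₀ : E) :
    ∃ x : ℝ → E, Continuous x ∧ ∀ t ∈ Icc 0 T, x t = x₀ + ∫ s in (0 : ℝ)..t, A s (x s) := by
  obtain ⟨c, hc⟩ := exists_exponential_weight hT ha
  have hexp : Continuous fun s : ℝ => Real.exp (c * s) := by fun_prop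
  have hext : ∀ z : C(Icc 0 T, E), Continuous fun s => Real.exp (c * s) • IccExtend hT z s :=
    fun z => hexp.smul (z.continuous.Icc_extend' (h := hT))
  have hprim : ∀ z : C(Icc 0 T, E), Continuous fun t : Icc 0 T =>
      Real.exp (-(c * t)) •
        (x₀ + ∫ s in (0 : ℝ)..t, A s (Real.exp (c * s) • IccExtend hT z s)) := fun z => by
    have h1 := intervalIntegral.continuousOn_primitive_interval
      ((intervalIntegrable_iff_integrableOn_Icc_of_le hT).1 (hA _ (hext z)) |>.mono_set
        (uIcc_of_le hT).subset)
    rw [uIcc_of_le hT] at h1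
    have h2 := continuousOn_iff_continuous_domRestrict.1 h1
    exact Continuous.smul (by fun_prop) (continuous_const.add h2)
  -- The Picard map written for `z(t) = exp(-ct) x(t)`: this amounts to using a weighted sup norm,
  -- in which it contracts on all of `[0, T]` at once.
  let Φ : C(Icc 0 T, E) → C(Icc 0 T, E) := fun z => ⟨_, hprim z⟩
  have hΦ : ContractingWith (1 / 2) Φ := by
    refine ⟨by norm_num, LipschitzWith.of_dist_le_mul fun y z => ?_⟩
    rw [ContinuousMap.dist_le (by positivity)]
    intro t
    have hsub : uIcc 0 (t : ℝ) ⊆ uIcc 0 T := by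
      rw [uIcc_of_le t.2.1, uIcc_of_le hT]; exact Icc_subset_Icc_right t.2.2
    have hy := (hA _ (hext y)).mono_set hsub
    have hz := (hA _ (hext z)).mono_set hsub
    simp only [Φ, ContinuousMap.coe_mk]
    rw [dist_eq_norm, ← smul_sub, add_sub_add_left_eq_sub, ← intervalIntegral.integral_sub hy hz,
      ← intervalIntegral.integral_smul]
    calc _ ≤ ∫ s in (0 : ℝ)..t, Real.exp (-(c * (t - s))) * a s * dist y z := by
          refine intervalIntegral.norm_integral_le_of_norm_le t.2.1
            (Eventually.of_forall fun s _ => ?_)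
            (((ha.mono_set hsub).continuousOn_mul (by fun_prop)).mul_const _)
          rw [← map_sub, ← smul_sub, norm_smul, map_smul, norm_smul, Real.norm_eq_abs,
            Real.norm_eq_abs, Real.abs_exp, Real.abs_exp, ← mul_assoc, ← Real.exp_add, mul_assoc,
            show -(c * (t : ℝ)) + c * s = -(c * (t - s)) by ring]
          refine mul_le_mul_of_nonneg_left ?_ (Real.exp_pos _).le
          refine ((A s).le_opNorm _).trans ?_
          gcongr
          · exact (norm_nonneg _).trans (hAa s)
          · exact hAa s
          · rw [← dist_eq_norm]
            exact ContinuousMap.dist_apply_le_dist _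
      _ ≤ 1 / 2 * dist y z := by
          rw [intervalIntegral.integral_mul_const]
          exact mul_le_mul_of_nonneg_right (hc t t.2) dist_nonneg
      _ = _ := by simp
  obtain ⟨z, hz⟩ : ∃ z, Φ z = z := ⟨_, hΦ.fixedPoint_isFixedPt⟩
  refine ⟨_, hext z, fun t ht => ?_⟩
  have h := congrArg (fun z : C(Icc 0 T, E) => z ⟨t, ht⟩) hz
  simp only [Φ, ContinuousMap.coe_mk] at h
  simp only [IccExtend_of_mem hT z ht, ← h, smul_smul, ← Real.exp_add]
  simp

end Volterra

/-! ### Evolution equations driven by skew-adjoint operators -/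

section SkewSystem

variable {E : Type*} [NormedAddCommGroup E] [InnerProductSpace ℝ E] {L : ℕ}

/-- A uniformly bounded, strongly continuous family of skew-adjoint operators. -/
structure IsSkewFamily (D : Fin L → ℝ → E →L[ℝ] E) : Prop where
  continuous : ∀ l, Continuous fun p : ℝ × E => D l p.1 p.2
  skew : ∀ l s x y, ⟪D l s x, y⟫ = -⟪x, D l s y⟫
  bounded : ∃ C, 0 ≤ C ∧ ∀ l s, ‖D l s‖ ≤ C

/-- The operator `∑ₗ vₗ Dₗ(s)`. -/
def drift (D : Fin L → ℝ → E →L[ℝ] E) (v : EuclideanSpace ℝ (Fin L)) (s : ℝ) : E →L[ℝ] E :=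
  ∑ l, v l • D l s

/-- `x` solves `x' = ∑ₗ vₗ(t) Dₗ(t) x`, `x(0) = x₀` on `[0, T]`. -/
def IsDriftSolution (D : Fin L → ℝ → E →L[ℝ] E) (T : ℝ) (v : ℝ → EuclideanSpace ℝ (Fin L))
    (x₀ : E) (x : ℝ → E) : Prop :=
  ContinuousOn x (Icc 0 T) ∧
    ∀ t ∈ Icc 0 T, x t = x₀ + ∫ s in (0 : ℝ)..t, drift D (v s) s (x s)

theorem drift_sub (D : Fin L → ℝ → E →L[ℝ] E) (v w : EuclideanSpace ℝ (Fin L)) (s : ℝ) :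
    drift D (v - w) s = drift D v s - drift D w s := by
  simp [drift, sub_smul]

theorem drift_apply (D : Fin L → ℝ → E →L[ℝ] E) (v : EuclideanSpace ℝ (Fin L)) (s : ℝ) (x : E) :
    drift D v s x = ∑ l, v l • D l s x := by
  simp [drift]

/-- The product rule for functions that are primitives on `[0, T]`. -/
theorem inner_eq_add_integral_of_primitive [CompleteSpace E] {f g F G : ℝ → E} {f₀ g₀ : E} {T : ℝ}
    (hF : IntervalIntegrable F volume 0 T) (hG : IntervalIntegrable G volume 0 T)
    (hf : ∀ t ∈ Icc 0 T, f t = f₀ + ∫ s in (0 : ℝ)..t, F s)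
    (hg : ∀ t ∈ Icc 0 T, g t = g₀ + ∫ s in (0 : ℝ)..t, G s) {t : ℝ} (ht : t ∈ Icc 0 T) :
    ⟪f t, g t⟫ = ⟪f₀, g₀⟫ + ∫ s in (0 : ℝ)..t, (⟪f s, G s⟫ + ⟪F s, g s⟫) := by
  have hsub : uIcc 0 t ⊆ uIcc 0 T := by
    rw [uIcc_of_le ht.1, uIcc_of_le (ht.1.trans ht.2)]; exact Icc_subset_Icc_right ht.2
  rw [hf t ht, hg t ht,
    inner_primitive_eq_add_integral f₀ g₀ (hF.mono_set hsub) (hG.mono_set hsub)]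
  congr 1
  refine intervalIntegral.integral_congr fun s hs => ?_
  rw [uIcc_of_le ht.1] at hs
  simp only [hf s ⟨hs.1, hs.2.trans ht.2⟩, hg s ⟨hs.1, hs.2.trans ht.2⟩]

namespace IsSkewFamily

variable {D : Fin L → ℝ → E →L[ℝ] E}

theorem drift_skew (hD : IsSkewFamily D) (v : EuclideanSpace ℝ (Fin L)) (s : ℝ) (x y : E) :
    ⟪drift D v s x, y⟫ = -⟪x, drift D v s y⟫ := by
  simp [drift_apply, sum_inner, inner_sum, real_inner_smul_left, real_inner_smul_right, hD.skew]

theorem inner_drift_self (hD : IsSkewFamily D) (v : EuclideanSpace ℝ (Fin L)) (s : ℝ) (x : E) :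
    ⟪x, drift D v s x⟫ = 0 := by
  have := hD.drift_skew v s x x
  rw [real_inner_comm] at this
  linarith

theorem exists_norm_drift_le (hD : IsSkewFamily D) :
    ∃ K, 0 ≤ K ∧ ∀ v s, ‖drift D v s‖ ≤ K * ‖v‖ := by
  obtain ⟨C, hC0, hC⟩ := hD.bounded
  refine ⟨L * C, by positivity, fun v s => ?_⟩
  calc ‖drift D v s‖ ≤ ∑ l : Fin L, ‖v‖ * C := by
        refine (norm_sum_le _ _).trans (Finset.sum_le_sum fun l _ => ?_)
        rw [norm_smul]
        exact mul_le_mul (PiLp.norm_apply_le v l) (hC l s) (norm_nonneg _) (norm_nonneg _)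
    _ = _ := by simp; ring

theorem continuousOn_apply (hD : IsSkewFamily D) {x : ℝ → E} {S : Set ℝ} (hx : ContinuousOn x S)
    (l : Fin L) : ContinuousOn (fun s => D l s (x s)) S :=
  (hD.continuous l).comp_continuousOn (continuousOn_id.prodMk hx)

theorem intervalIntegrable_drift (hD : IsSkewFamily D) {T : ℝ} (hT : 0 ≤ T)
    {v : ℝ → EuclideanSpace ℝ (Fin L)} (hv : IntervalIntegrable v volume 0 T) {x : ℝ → E}
    (hx : ContinuousOn x (Icc 0 T)) :
    IntervalIntegrable (fun s => drift D (v s) s (x s)) volume 0 T := by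
  simp only [drift_apply]
  have h : ∀ l ∈ Finset.univ, IntervalIntegrable (fun s => v s l • D l s (x s)) volume 0 T := by
    intro l _
    have hvl : IntervalIntegrable (fun s => v s l) volume 0 T := by
      rw [intervalIntegrable_iff] at hv ⊢
      exact (EuclideanSpace.proj (𝕜 := ℝ) l).integrable_comp hv
    exact hvl.smul_continuousOn (by rw [uIcc_of_le hT]; exact hD.continuousOn_apply hx l)
  simpa [Finset.sum_fn] using IntervalIntegrable.sum _ h

theorem exists_isDriftSolution [CompleteSpace E] (hD : IsSkewFamily D) {T : ℝ} (hT : 0 ≤ T)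
    {v : ℝ → EuclideanSpace ℝ (Fin L)} (hv : IntervalIntegrable v volume 0 T) (x₀ : E) :
    ∃ x, IsDriftSolution D T v x₀ x := by
  obtain ⟨K, -, hK⟩ := hD.exists_norm_drift_le
  obtain ⟨x, hx, hxt⟩ := exists_volterra_solution hT (A := fun s => drift D (v s) s)
    (hv.norm.const_mul K) (fun s => hK (v s) s)
    (fun x hx => hD.intervalIntegrable_drift hT hv hx.continuousOn) x₀
  exact ⟨x, hx.continuousOn, hxt⟩

theorem comp_sub_left_neg (hD : IsSkewFamily D) (T : ℝ) :
    IsSkewFamily fun l s => -D l (T - s) where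
  continuous l := by
    have := (hD.continuous l).comp
      ((continuous_const.sub continuous_fst).prodMk continuous_snd : Continuous
        fun p : ℝ × E => (T - p.1, p.2))
    exact this.neg
  skew l s x y := by simp [hD.skew]
  bounded := by
    obtain ⟨C, hC0, hC⟩ := hD.bounded
    exact ⟨C, hC0, fun l s => by simpa using hC l (T - s)⟩

/-- Time reversal: `y(τ) = χ(T - τ)` solves an initial value problem with field `v(T - ·)` and
family `-D(T - ·)`, which is again skew. This produces the adjoint state. -/
theorem exists_isDriftSolution_terminal [CompleteSpace E] (hD : IsSkewFamily D) {T : ℝ}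
    (hT : 0 ≤ T) {v : ℝ → EuclideanSpace ℝ (Fin L)} (hv : IntervalIntegrable v volume 0 T)
    (η : E) : ∃ χ₀ χ, IsDriftSolution D T v χ₀ χ ∧ χ T = η := by
  have hv' : IntervalIntegrable (fun s => v (T - s)) volume 0 T := by
    simpa using (hv.comp_sub_left T).symm
  obtain ⟨y, hy, hyt⟩ := (hD.comp_sub_left_neg T).exists_isDriftSolution hT hv' η
  have hχ : ContinuousOn (fun t => y (T - t)) (Icc 0 T) :=
    hy.comp (by fun_prop) fun t ht => ⟨by linarith [ht.2], by linarith [ht.1]⟩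
  have hint := hD.intervalIntegrable_drift hT hv hχ
  have hrev : ∀ t ∈ Icc 0 T, y (T - t) = η - ∫ s in t..T, drift D (v s) s (y (T - s)) := by
    intro t ht
    rw [hyt _ ⟨by linarith [ht.2], by linarith [ht.1]⟩, sub_eq_add_neg η]
    congr 1
    have h := intervalIntegral.integral_comp_sub_left
      (fun s => drift D (v s) s (y (T - s))) T (a := 0) (b := T - t)
    simp only [sub_sub_cancel, sub_zero] at h
    rw [← h, ← intervalIntegral.integral_neg]
    simp [drift_apply]
  refine ⟨y T, fun t => y (T - t), ⟨hχ, fun t ht => ?_⟩, ?_⟩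
  · have h0 := hrev 0 ⟨le_rfl, hT⟩
    rw [sub_zero] at h0
    have hsub1 : uIcc 0 t ⊆ uIcc 0 T := by
      rw [uIcc_of_le ht.1, uIcc_of_le hT]; exact Icc_subset_Icc_right ht.2
    have hsub2 : uIcc t T ⊆ uIcc 0 T := by
      rw [uIcc_of_le ht.2, uIcc_of_le hT]; exact Icc_subset_Icc_left ht.1
    simp only [hrev t ht]
    rw [h0, ← intervalIntegral.integral_add_adjacent_intervals (hint.mono_set hsub1)
      (hint.mono_set hsub2)]
    abel
  · simpa using hrev T ⟨hT, le_rfl⟩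

/-- The leading `0 +` gives the shape required by `inner_eq_add_integral_of_primitive`, with initial
value `0`. -/
theorem sub_eq_integral (hD : IsSkewFamily D) {T : ℝ} (hT : 0 ≤ T)
    {v v' : ℝ → EuclideanSpace ℝ (Fin L)} {x₀ : E} {x y : ℝ → E}
    (hv : IntervalIntegrable v volume 0 T) (hv' : IntervalIntegrable v' volume 0 T)
    (hx : IsDriftSolution D T v x₀ x) (hy : IsDriftSolution D T v' x₀ y) {t : ℝ}
    (ht : t ∈ Icc 0 T) :
    y t - x t = 0 + ∫ s in (0 : ℝ)..t, (drift D (v' s) s (y s) - drift D (v s) s (x s)) := by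
  have hsub : uIcc 0 t ⊆ uIcc 0 T := by
    rw [uIcc_of_le ht.1, uIcc_of_le hT]; exact Icc_subset_Icc_right ht.2
  rw [intervalIntegral.integral_sub ((hD.intervalIntegrable_drift hT hv' hy.1).mono_set hsub)
    ((hD.intervalIntegrable_drift hT hv hx.1).mono_set hsub), hx.2 t ht, hy.2 t ht]
  abel

end IsSkewFamily

end SkewSystem

/-! ### Sensitivity of the state and the adjoint gradient -/

section Sensitivity

variable {E : Type*} [NormedAddCommGroup E] [InnerProductSpace ℝ E] [CompleteSpace E] {L : ℕ}
  {D : Fin L → ℝ → E →L[ℝ] E} {T : ℝ} {v : ℝ → EuclideanSpace ℝ (Fin L)} {x₀ : E} {x : ℝ → E}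

theorem integral_mono_upper {f : ℝ → ℝ} (hf : IntervalIntegrable f volume 0 T)
    (h0 : ∀ s, 0 ≤ f s) {t : ℝ} (ht : t ∈ Icc 0 T) :
    ∫ s in (0 : ℝ)..t, f s ≤ ∫ s in (0 : ℝ)..T, f s :=
  intervalIntegral.integral_mono_interval le_rfl ht.1 ht.2 (Eventually.of_forall h0) hf

namespace IsSkewFamily

/-- The state depends Lipschitz continuously on the field in `L¹`. -/
theorem exists_norm_sub_le (hD : IsSkewFamily D) (hT : 0 ≤ T)
    (hv : IntervalIntegrable v volume 0 T) (hx : IsDriftSolution D T v x₀ x) :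
    ∃ C, 0 ≤ C ∧ ∀ v' y, IntervalIntegrable v' volume 0 T → IsDriftSolution D T v' x₀ y →
      ∀ t ∈ Icc 0 T, ‖y t - x t‖ ≤ C * ∫ s in (0 : ℝ)..T, ‖v' s - v s‖ := by
  obtain ⟨K, hK0, hK⟩ := hD.exists_norm_drift_le
  obtain ⟨R, hR⟩ := isCompact_Icc.exists_bound_of_continuousOn hx.1
  have hR0 : 0 ≤ R := (norm_nonneg _).trans (hR 0 ⟨le_rfl, hT⟩)
  refine ⟨2 * (K * R), by positivity, fun v' y hv' hy t ht => ?_⟩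
  set N := ∫ s in (0 : ℝ)..T, ‖v' s - v s‖
  have hz : ContinuousOn (fun s => y s - x s) (Icc 0 T) := hy.1.sub hx.1
  -- The energy identity for `y - x` is evaluated where its norm attains the maximum `M`. It gives
  -- `M² ≤ 2 M K R N`, and dividing by `M` replaces Gronwall.
  obtain ⟨m, hm, hmax⟩ := isCompact_Icc.exists_isMaxOn ⟨t, ht⟩ hz.norm
  refine (hmax ht).trans ?_
  have hI := (hD.intervalIntegrable_drift hT hv' hy.1).sub (hD.intervalIntegrable_drift hT hv hx.1)
  have henergy := inner_eq_add_integral_of_primitive hI hI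
    (fun s hs => hD.sub_eq_integral hT hv hv' hx hy hs)
    (fun s hs => hD.sub_eq_integral hT hv hv' hx hy hs) hm
  have hvv : IntervalIntegrable (fun s => ‖v' s - v s‖) volume 0 T := (hv'.sub hv).norm
  set M := ‖y m - x m‖
  have hbound : M * M ≤ 2 * (M * (K * R)) * N := by
    rw [real_inner_self_eq_norm_mul_norm, inner_zero_left, zero_add] at henergy
    change M * M = _ at henergy
    rw [henergy]
    have hsub : uIcc 0 m ⊆ uIcc 0 T := by
      rw [uIcc_of_le hm.1, uIcc_of_le hT]; exact Icc_subset_Icc_right hm.2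
    calc _ ≤ ∫ s in (0 : ℝ)..m, 2 * (M * (K * R)) * ‖v' s - v s‖ := by
          refine (Real.le_norm_self _).trans (intervalIntegral.norm_integral_le_of_norm_le hm.1
            (Eventually.of_forall fun s hs => ?_) ((hvv.mono_set hsub).const_mul _))
          have hs' : s ∈ Icc 0 T := ⟨hs.1.le, hs.2.trans hm.2⟩
          -- The part carrying the possibly large field `v'` acts on `y - x` itself, so skewness
          -- kills it in the energy identity.
          have hdec : drift D (v' s) s (y s) - drift D (v s) s (x s) =
              drift D (v' s) s (y s - x s) + drift D (v' s - v s) s (x s) := by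
            rw [drift_sub, map_sub, sub_apply]; abel
          have h1 : ⟪y s - x s, drift D (v' s) s (y s) - drift D (v s) s (x s)⟫ =
              ⟪y s - x s, drift D (v' s - v s) s (x s)⟫ := by
            rw [hdec, inner_add_right, hD.inner_drift_self, zero_add]
          rw [real_inner_comm (y s - x s), h1, ← two_mul, norm_mul]
          have h2 : ‖⟪y s - x s, drift D (v' s - v s) s (x s)⟫‖ ≤
              M * (K * ‖v' s - v s‖ * R) := by
            refine (norm_inner_le_norm _ _).trans ?_
            refine mul_le_mul (hmax hs') ?_ (norm_nonneg _) (norm_nonneg _)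
            refine ((drift D (v' s - v s) s).le_opNorm _).trans ?_
            exact mul_le_mul (hK _ _) (hR s hs') (norm_nonneg _) (by positivity)
          simp only [Real.norm_ofNat]
          linarith
      _ = 2 * (M * (K * R)) * ∫ s in (0 : ℝ)..m, ‖v' s - v s‖ := by
          rw [intervalIntegral.integral_const_mul]
      _ ≤ _ := by
          gcongr
          exact integral_mono_upper hvv (fun _ => norm_nonneg _) hm
  have hM0 : 0 ≤ M := norm_nonneg _
  rcases hM0.eq_or_lt with h0 | h0
  · change M ≤ _
    rw [← h0]
    have : 0 ≤ N := intervalIntegral.integral_nonneg hT fun _ _ => norm_nonneg _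
    positivity
  · refine le_of_mul_le_mul_left ?_ h0
    change M * M ≤ _
    linarith

/-- Duality between the linearised state equation and the adjoint equation. -/
theorem inner_sub_eq_integral (hD : IsSkewFamily D) (hT : 0 ≤ T)
    {v' : ℝ → EuclideanSpace ℝ (Fin L)} {y χ : ℝ → E} {χ₀ : E}
    (hv : IntervalIntegrable v volume 0 T) (hv' : IntervalIntegrable v' volume 0 T)
    (hx : IsDriftSolution D T v x₀ x) (hy : IsDriftSolution D T v' x₀ y)
    (hχ : IsDriftSolution D T v χ₀ χ) :
    ⟪χ T, y T - x T⟫ = ∫ s in (0 : ℝ)..T, ⟪χ s, drift D (v' s - v s) s (y s)⟫ := by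
  have hI := (hD.intervalIntegrable_drift hT hv' hy.1).sub (hD.intervalIntegrable_drift hT hv hx.1)
  rw [inner_eq_add_integral_of_primitive (hD.intervalIntegrable_drift hT hv hχ.1) hI hχ.2
    (fun s hs => hD.sub_eq_integral hT hv hv' hx hy hs) ⟨hT, le_rfl⟩, inner_zero_right, zero_add]
  -- Moving the drift of `χ` onto `y - x` cancels every term with `v` except the one in `v' - v`.
  -- The identity is exact because the perturbed state `y` is kept.
  refine intervalIntegral.integral_congr fun s _ => ?_
  simp only [hD.drift_skew, drift_sub, map_sub, sub_apply, inner_sub_right]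
  ring

/-- Differentiability of linear functionals of the terminal state with respect to the field in
`L¹`, with a continuous gradient. -/
theorem exists_gradient (hD : IsSkewFamily D) (hT : 0 ≤ T)
    (hv : IntervalIntegrable v volume 0 T) (hx : IsDriftSolution D T v x₀ x) (η : E) :
    ∃ g : ℝ → EuclideanSpace ℝ (Fin L), ContinuousOn g (Icc 0 T) ∧ ∃ C,
      ∀ v' y, IntervalIntegrable v' volume 0 T → IsDriftSolution D T v' x₀ y →
        |⟪η, y T - x T⟫ - ∫ s in (0 : ℝ)..T, ⟪g s, v' s - v s⟫| ≤
          C * (∫ s in (0 : ℝ)..T, ‖v' s - v s‖) ^ 2 := by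
  obtain ⟨K, hK0, hK⟩ := hD.exists_norm_drift_le
  obtain ⟨C, hC0, hC⟩ := hD.exists_norm_sub_le hT hv hx
  obtain ⟨χ₀, χ, hχ, rfl⟩ := hD.exists_isDriftSolution_terminal hT hv η
  obtain ⟨R, hR⟩ := isCompact_Icc.exists_bound_of_continuousOn hχ.1
  have hR0 : 0 ≤ R := (norm_nonneg _).trans (hR 0 ⟨le_rfl, hT⟩)
  refine ⟨fun s => WithLp.toLp 2 fun l => ⟪χ s, D l s (x s)⟫, ?_, R * K * C,
    fun v' y hv' hy => ?_⟩
  · exact (PiLp.continuous_toLp 2 _).comp_continuousOn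
      (continuousOn_pi.2 fun l => hχ.1.inner (𝕜 := ℝ) (hD.continuousOn_apply hx.1 l))
  set N := ∫ s in (0 : ℝ)..T, ‖v' s - v s‖
  have hvv : IntervalIntegrable (fun s => ‖v' s - v s‖) volume 0 T := (hv'.sub hv).norm
  have hg : ∀ s, ⟪WithLp.toLp 2 fun l => ⟪χ s, D l s (x s)⟫, v' s - v s⟫ =
      ⟪χ s, drift D (v' s - v s) s (x s)⟫ := fun s => by
    simp [drift_apply, inner_sum, real_inner_smul_right, PiLp.inner_apply]
  have hint : ∀ z : ℝ → E, ContinuousOn z (Icc 0 T) →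
      IntervalIntegrable (fun s => ⟪χ s, drift D (v' s - v s) s (z s)⟫) volume 0 T := by
    intro z hz
    have h := hD.intervalIntegrable_drift hT (hv'.sub hv) hz
    simp only [drift_apply, inner_sum, real_inner_smul_right] at h ⊢
    have hl : ∀ l ∈ Finset.univ, IntervalIntegrable
        (fun s => (v' s - v s) l * ⟪χ s, D l s (z s)⟫) volume 0 T := by
      intro l _
      have hvl : IntervalIntegrable (fun s => (v' s - v s) l) volume 0 T := by
        have := hv'.sub hv
        rw [intervalIntegrable_iff] at this ⊢
        exact (EuclideanSpace.proj (𝕜 := ℝ) l).integrable_comp this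
      refine hvl.mul_continuousOn ?_
      rw [uIcc_of_le hT]
      exact hχ.1.inner (𝕜 := ℝ) (hD.continuousOn_apply hz l)
    simpa [Finset.sum_fn] using IntervalIntegrable.sum _ hl
  simp only [hg]
  -- Replacing `y` by `x` in the duality formula leaves `∫ ⟨χ, drift(v' - v)(y - x)⟩`. It is
  -- quadratic, since `y - x` is also of order `N`.
  rw [hD.inner_sub_eq_integral hT hv hv' hx hy hχ,
    ← intervalIntegral.integral_sub (hint y hy.1) (hint x hx.1), ← Real.norm_eq_abs]
  calc _ ≤ ∫ s in (0 : ℝ)..T, R * K * (C * N) * ‖v' s - v s‖ := by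
        refine intervalIntegral.norm_integral_le_of_norm_le hT
          (Eventually.of_forall fun s hs => ?_) (hvv.const_mul _)
        have hs' : s ∈ Icc 0 T := ⟨hs.1.le, hs.2⟩
        rw [← inner_sub_right, ← map_sub]
        calc _ ≤ ‖χ s‖ * ‖drift D (v' s - v s) s (y s - x s)‖ := norm_inner_le_norm _ _
          _ ≤ R * (K * ‖v' s - v s‖ * (C * N)) := by
            refine mul_le_mul (hR s hs') ?_ (norm_nonneg _) hR0
            refine ((drift D (v' s - v s) s).le_opNorm _).trans ?_
            exact mul_le_mul (hK _ _) (hC v' y hv' hy s hs') (norm_nonneg _) (by positivity)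
          _ = _ := by ring
    _ = R * K * C * N ^ 2 := by
        rw [intervalIntegral.integral_const_mul]; ring

end IsSkewFamily

end Sensitivity

/-! The estimates below use only that `exp(-i t H₀)` is a strongly continuous one-parameter group of
unitary operators; the generator itself does not enter. -/

/-! ### Interaction picture and the gradient of the observable -/

section QuantumDynamics

attribute [local instance] InnerProductSpace.complexToReal

variable {H : Type*} [NormedAddCommGroup H] [InnerProductSpace ℂ H] {L : ℕ}

/-- The default value `fun _ => 1` is itself a unitary group, so both branches of the definition
obey the group laws. -/
theorem unitaryGroup_zero (H₀ : H →ₗ.[ℂ] H) : unitaryGroup H₀ 0 = 1 := by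
  unfold unitaryGroup
  split_ifs with h
  · exact h.choose_spec.map_zero
  · rfl

theorem unitaryGroup_add (H₀ : H →ₗ.[ℂ] H) (s t : ℝ) :
    unitaryGroup H₀ (s + t) = unitaryGroup H₀ s * unitaryGroup H₀ t := by
  unfold unitaryGroup
  split_ifs with h
  · exact h.choose_spec.map_add s t
  · simp

theorem unitaryGroup_add_apply (H₀ : H →ₗ.[ℂ] H) (s t : ℝ) (x : H) :
    unitaryGroup H₀ (s + t) x = unitaryGroup H₀ s (unitaryGroup H₀ t x) := by
  rw [unitaryGroup_add]; rfl

theorem unitaryGroup_neg_apply_self (H₀ : H →ₗ.[ℂ] H) (t : ℝ) (x : H) :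
    unitaryGroup H₀ (-t) (unitaryGroup H₀ t x) = x := by
  rw [← unitaryGroup_add_apply, neg_add_cancel, unitaryGroup_zero]; rfl

theorem unitaryGroup_apply_neg_self (H₀ : H →ₗ.[ℂ] H) (t : ℝ) (x : H) :
    unitaryGroup H₀ t (unitaryGroup H₀ (-t) x) = x := by
  simpa using unitaryGroup_neg_apply_self H₀ (-t) x

/-- Strong continuity upgrades to joint continuity because all the maps are `1`-Lipschitz. -/
theorem continuous_unitaryGroup (H₀ : H →ₗ.[ℂ] H) :
    Continuous fun p : ℝ × H => unitaryGroup H₀ p.1 p.2 := by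
  have h : ∀ x, Continuous fun t => unitaryGroup H₀ t x := by
    unfold unitaryGroup
    split_ifs with h
    · exact h.choose_spec.continuous
    · exact fun x => continuous_const
  exact continuous_prod_of_continuous_lipschitzWith' (K := 1) _
    (fun t => (unitaryGroup H₀ t).lipschitz) h

theorem inner_unitaryGroup_neg (H₀ : H →ₗ.[ℂ] H) (t : ℝ) (x y : H) :
    ⟪unitaryGroup H₀ (-t) x, y⟫ = ⟪x, unitaryGroup H₀ t y⟫ := by
  rw [real_inner_eq_re_inner ℂ, real_inner_eq_re_inner ℂ,
    ← (unitaryGroup H₀ t).inner_map_map, unitaryGroup_apply_neg_self]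

/-- The control operators `-i Hₗ` in the interaction picture. -/
noncomputable def interactionFamily (H₀ : H →ₗ.[ℂ] H) (Hc : Fin L → H →L[ℂ] H) (l : Fin L) (s : ℝ) :
    H →L[ℝ] H :=
  (((unitaryGroup H₀ (-s)).toContinuousLinearEquiv : H →L[ℂ] H) ∘L (-Complex.I • Hc l) ∘L
    ((unitaryGroup H₀ s).toContinuousLinearEquiv : H →L[ℂ] H)).restrictScalars ℝ

theorem interactionFamily_apply (H₀ : H →ₗ.[ℂ] H) (Hc : Fin L → H →L[ℂ] H) (l : Fin L) (s : ℝ)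
    (x : H) : interactionFamily H₀ Hc l s x =
      unitaryGroup H₀ (-s) (-Complex.I • Hc l (unitaryGroup H₀ s x)) := rfl

theorem isSkewFamily_interactionFamily [CompleteSpace H] (H₀ : H →ₗ.[ℂ] H)
    {Hc : Fin L → H →L[ℂ] H} (hHc : ∀ l, IsSelfAdjoint (Hc l)) :
    IsSkewFamily (interactionFamily H₀ Hc) where
  continuous l := by
    simp only [interactionFamily_apply]
    exact (continuous_unitaryGroup H₀).comp (continuous_fst.neg.prodMk
      (((Hc l).continuous.comp (continuous_unitaryGroup H₀)).const_smul _))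
  skew l s x y := by
    have hsa : ∀ a b, inner ℂ (Hc l a) b = inner ℂ a (Hc l b) :=
      ContinuousLinearMap.isSelfAdjoint_iff_isSymmetric.1 (hHc l)
    have hG : ∀ z, ⟪x, unitaryGroup H₀ (-s) z⟫ = ⟪unitaryGroup H₀ s x, z⟫ := fun z => by
      rw [real_inner_comm, inner_unitaryGroup_neg, real_inner_comm]
    rw [interactionFamily_apply, interactionFamily_apply, inner_unitaryGroup_neg, hG,
      real_inner_eq_re_inner ℂ, real_inner_eq_re_inner ℂ, inner_smul_left, inner_smul_right, hsa]
    simp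
  bounded := by
    refine ⟨∑ l, ‖Hc l‖, by positivity, fun l s => ?_⟩
    refine ContinuousLinearMap.opNorm_le_bound _ (by positivity) fun x => ?_
    rw [interactionFamily_apply, LinearIsometryEquiv.norm_map, norm_smul]
    have h1 : ‖Hc l‖ ≤ ∑ l, ‖Hc l‖ :=
      Finset.single_le_sum (f := fun l => ‖Hc l‖) (fun _ _ => norm_nonneg _) (Finset.mem_univ l)
    have h2 := (Hc l).le_opNorm (unitaryGroup H₀ s x)
    rw [LinearIsometryEquiv.norm_map] at h2
    simpa using h2.trans (mul_le_mul_of_nonneg_right h1 (norm_nonneg _))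

/-- Mild solutions are the solutions of the evolution equation in the interaction picture. -/
theorem isMildSolution_iff_isDriftSolution [CompleteSpace H] (T : ℝ) (H₀ : H →ₗ.[ℂ] H)
    (Hc : Fin L → H →L[ℂ] H) (ψ₀ : H) (v : ℝ → EuclideanSpace ℝ (Fin L)) (ψ : ℝ → H) :
    IsMildSolution T H₀ Hc ψ₀ v ψ ↔
      IsDriftSolution (interactionFamily H₀ Hc) T v ψ₀ fun t => unitaryGroup H₀ (-t) (ψ t) := by
  refine and_congr ⟨fun h => ?_, fun h => ?_⟩ (forall₂_congr fun t ht => ?_)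
  · exact (continuous_unitaryGroup H₀).comp_continuousOn (continuousOn_id.neg.prodMk h)
  · exact ((continuous_unitaryGroup H₀).comp_continuousOn (continuousOn_id.prodMk h)).congr
      fun t _ => (unitaryGroup_apply_neg_self H₀ t (ψ t)).symm
  · rw [← (unitaryGroup H₀ (-t)).injective.eq_iff, map_add, unitaryGroup_neg_apply_self]
    have h : unitaryGroup H₀ (-t) (∫ s in (0 : ℝ)..t,
          unitaryGroup H₀ (t - s) (∑ l, v s l • (-Complex.I • Hc l (ψ s)))) =
        ∫ s in (0 : ℝ)..t, drift (interactionFamily H₀ Hc) (v s) s (unitaryGroup H₀ (-s) (ψ s)) := by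
      rw [intervalIntegral.integral_of_le ht.1, intervalIntegral.integral_of_le ht.1]
      -- An invertible operator passes through the Bochner integral without an integrability
      -- condition, so `v` may be arbitrary.
      refine ((unitaryGroup H₀ (-t)).toContinuousLinearEquiv.integral_comp_comm _).symm.trans ?_
      refine integral_congr_ae (Eventually.of_forall fun s => ?_)
      simp only [LinearIsometryEquiv.coe_toContinuousLinearEquiv, drift_apply,
        interactionFamily_apply, unitaryGroup_apply_neg_self]
      rw [← unitaryGroup_add_apply, show -t + (t - s) = -s by ring, map_sum]
      refine Finset.sum_congr rfl fun l _ => ?_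
      exact ((unitaryGroup H₀ (-s)).toContinuousLinearEquiv : H →L[ℂ] H).restrictScalars ℝ
        |>.map_smul _ _
    rw [h]

theorem isMildSolution_stateOf [CompleteSpace H] {T : ℝ} (hT : 0 ≤ T) (H₀ : H →ₗ.[ℂ] H)
    {Hc : Fin L → H →L[ℂ] H} (hHc : ∀ l, IsSelfAdjoint (Hc l)) (ψ₀ : H)
    {v : ℝ → EuclideanSpace ℝ (Fin L)} (hv : IntervalIntegrable v volume 0 T) :
    IsMildSolution T H₀ Hc ψ₀ v (stateOf T H₀ Hc ψ₀ v) := by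
  have h : ∃ ψ, IsMildSolution T H₀ Hc ψ₀ v ψ := by
    obtain ⟨x, hx⟩ := (isSkewFamily_interactionFamily H₀ hHc).exists_isDriftSolution hT hv ψ₀
    refine ⟨fun t => unitaryGroup H₀ t (x t), ?_⟩
    rw [isMildSolution_iff_isDriftSolution]
    simpa only [unitaryGroup_neg_apply_self] using hx
  rw [stateOf, dif_pos h]
  exact h.choose_spec

/-- The quadratic observable at the final time is differentiable with respect to the field in
`L¹`, with a continuous gradient. -/
theorem exists_observable_gradient [CompleteSpace H] {T : ℝ} (hT : 0 ≤ T) (H₀ : H →ₗ.[ℂ] H)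
    {Hc : Fin L → H →L[ℂ] H} (hHc : ∀ l, IsSelfAdjoint (Hc l)) (ψ₀ : H) (O : H →L[ℝ] H)
    {v : ℝ → EuclideanSpace ℝ (Fin L)} (hv : IntervalIntegrable v volume 0 T) :
    ∃ g : ℝ → EuclideanSpace ℝ (Fin L), ContinuousOn g (Icc 0 T) ∧ ∃ C,
      ∀ v', IntervalIntegrable v' volume 0 T →
        |⟪stateOf T H₀ Hc ψ₀ v' T, O (stateOf T H₀ Hc ψ₀ v' T)⟫ -
            ⟪stateOf T H₀ Hc ψ₀ v T, O (stateOf T H₀ Hc ψ₀ v T)⟫ -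
            ∫ s in (0 : ℝ)..T, ⟪g s, v' s - v s⟫| ≤
          C * (∫ s in (0 : ℝ)..T, ‖v' s - v s‖) ^ 2 := by
  have hD := isSkewFamily_interactionFamily H₀ hHc
  set ψ := stateOf T H₀ Hc ψ₀ v
  have hsol : ∀ {v}, IntervalIntegrable v volume 0 T →
      IsDriftSolution (interactionFamily H₀ Hc) T v ψ₀
        fun t => unitaryGroup H₀ (-t) (stateOf T H₀ Hc ψ₀ v t) := fun hv =>
    (isMildSolution_iff_isDriftSolution ..).1 (isMildSolution_stateOf hT H₀ hHc ψ₀ hv)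
  obtain ⟨C₁, hC₁0, hC₁⟩ := hD.exists_norm_sub_le hT hv (hsol hv)
  -- The terminal value is the derivative `(O + O*) ψ(T)` of the quadratic form, with the real
  -- adjoint, transported to the interaction picture.
  obtain ⟨g, hg, C₂, hC₂⟩ := hD.exists_gradient hT hv (hsol hv)
    (unitaryGroup H₀ (-T) (O (ψ T) + ContinuousLinearMap.adjoint O (ψ T)))
  refine ⟨g, hg, C₂ + ‖O‖ * C₁ ^ 2, fun v' hv' => ?_⟩
  have h1 := hC₁ v' _ hv' (hsol hv') T ⟨hT, le_rfl⟩
  have h2 := hC₂ v' _ hv' (hsol hv')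
  set ψ' := stateOf T H₀ Hc ψ₀ v'
  set N := ∫ s in (0 : ℝ)..T, ‖v' s - v s‖
  rw [← map_sub] at h1 h2
  rw [LinearIsometryEquiv.norm_map] at h1
  rw [inner_unitaryGroup_neg, unitaryGroup_apply_neg_self] at h2
  have hquad : |⟪ψ' T - ψ T, O (ψ' T - ψ T)⟫| ≤ ‖O‖ * (C₁ * N) ^ 2 := by
    calc _ ≤ ‖ψ' T - ψ T‖ * ‖O (ψ' T - ψ T)‖ := abs_real_inner_le_norm _ _
      _ ≤ ‖ψ' T - ψ T‖ * (‖O‖ * ‖ψ' T - ψ T‖) := by gcongr; exact O.le_opNorm _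
      _ = ‖O‖ * ‖ψ' T - ψ T‖ ^ 2 := by ring
      _ ≤ _ := by gcongr
  have hexpand : ⟪ψ' T, O (ψ' T)⟫ - ⟪ψ T, O (ψ T)⟫ =
      ⟪O (ψ T) + ContinuousLinearMap.adjoint O (ψ T), ψ' T - ψ T⟫ +
        ⟪ψ' T - ψ T, O (ψ' T - ψ T)⟫ := by
    rw [inner_add_left, ContinuousLinearMap.adjoint_inner_left,
      real_inner_comm (ψ' T - ψ T) (O (ψ T))]
    simp only [map_sub, inner_sub_left, inner_sub_right]
    ring
  rw [hexpand, add_sub_right_comm]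
  refine (abs_add_le _ _).trans ((add_le_add h2 hquad).trans (le_of_eq ?_))
  ring

end QuantumDynamics

/-! ### Restricting and shrinking measures -/

section Restriction

variable {Ω : Type*} [TopologicalSpace Ω] [T2Space Ω] [MeasurableSpace Ω] [BorelSpace Ω]
variable {U : Type*} [NormedAddCommGroup U] [InnerProductSpace ℝ U]

/-- The restriction of a vector measure of finite mass to a measurable set. -/
noncomputable def FiniteMassMeasure.restrict (u : FiniteMassMeasure Ω U) {A : Set Ω}
    (hA : MeasurableSet A) : FiniteMassMeasure Ω U :=
  ⟨(u : VectorMeasure Ω U).restrict A, by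
    have hfin : IsFiniteMeasure u.totalVariation := u.2.1
    have hreg : u.totalVariation.Regular := u.2.2
    have h : ((u : VectorMeasure Ω U).restrict A).variation ≤ u.totalVariation := by
      rw [VectorMeasure.variation_restrict hA]; exact Measure.restrict_le_self
    exact ⟨isFiniteMeasure_of_le _ h, regular_of_le h⟩⟩

namespace FiniteMassMeasure

theorem totalVariation_restrict (u : FiniteMassMeasure Ω U) {A : Set Ω} (hA : MeasurableSet A) :
    (u.restrict hA).totalVariation = u.totalVariation.restrict A :=
  VectorMeasure.variation_restrict hA

theorem norm_restrict (u : FiniteMassMeasure Ω U) {A : Set Ω} (hA : MeasurableSet A) :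
    ‖u.restrict hA‖ = u.totalVariation.real A := by
  rw [norm_def, totalVariation_restrict]; simp

theorem restrict_add_restrict_compl (u : FiniteMassMeasure Ω U) {A : Set Ω}
    (hA : MeasurableSet A) : u.restrict hA + u.restrict hA.compl = u := by
  apply Subtype.ext
  exact VectorMeasure.restrict_add_restrict_compl hA

/-- The perturbed measure is `(1 - ε) u` on `A` and `u` on the complement, and `|u|` is additive
over the two pieces. The bound `ε ≤ 1` keeps the factor nonnegative. -/
theorem norm_sub_smul_restrict_le (u : FiniteMassMeasure Ω U) {A : Set Ω}
    (hA : MeasurableSet A) {ε : ℝ} (hε : ε ≤ 1) :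
    ‖u - ε • u.restrict hA‖ ≤ ‖u‖ - ε * u.totalVariation.real A := by
  have h1 : u - ε • u.restrict hA = (1 - ε) • u.restrict hA + u.restrict hA.compl := by
    nth_rw 1 [← u.restrict_add_restrict_compl hA]
    module
  have h2 : ‖u‖ = u.totalVariation.real A + u.totalVariation.real Aᶜ := by
    rw [norm_def, measureReal_add_measureReal_compl hA]
  rw [h1]
  refine (norm_add_le _ _).trans (le_of_eq ?_)
  rw [norm_smul, norm_restrict, norm_restrict, Real.norm_of_nonneg (by linarith), h2]
  ring

theorem abs_pairing_restrict_le (u : FiniteMassMeasure Ω U) {A : Set Ω} (hA : MeasurableSet A)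
    (φ : ZeroAtInftyContinuousMap Ω U) :
    |pairing φ (u.restrict hA)| ≤ ∫ ω in A, ‖φ ω‖ ∂u.totalVariation := by
  rw [← Real.norm_eq_abs, ← totalVariation_restrict]
  refine VectorMeasure.norm_integral_le_integral_norm.trans ?_
  exact mul_le_of_le_one_left (integral_nonneg fun _ => norm_nonneg _) (norm_innerSL_le ℝ)

end FiniteMassMeasure

end Restriction

/-- A finite measure `μ` with `α μ(A) ≤ ∫_A ‖φ‖ dμ` for all measurable `A`, where `φ` vanishes at
infinity, has compact support. -/
theorem isCompact_support_of_forall_mul_le {Ω : Type*} [TopologicalSpace Ω] [MeasurableSpace Ω]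
    [BorelSpace Ω] {U : Type*} [NormedAddCommGroup U] {μ : Measure Ω} [IsFiniteMeasure μ] {α : ℝ}
    (hα : 0 < α) (φ : ZeroAtInftyContinuousMap Ω U)
    (h : ∀ A, MeasurableSet A → α * μ.real A ≤ ∫ ω in A, ‖φ ω‖ ∂μ) : IsCompact μ.support := by
  have hnorm : Continuous fun ω => ‖φ ω‖ := (map_continuous φ).norm
  have hopen : IsOpen {ω | ‖φ ω‖ < α} := isOpen_lt hnorm continuous_const
  set A := {ω | ‖φ ω‖ < α}
  have hint : IntegrableOn (fun ω => ‖φ ω‖) A μ :=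
    Measure.integrableOn_of_bounded (M := α) (measure_ne_top _ _) hnorm.aestronglyMeasurable
      ((ae_restrict_iff' hopen.measurableSet).2 (Eventually.of_forall fun ω hω => by
        rw [norm_norm]; exact le_of_lt hω))
  -- The integrand is strictly positive on `A`, so this sign forces `μ A = 0`.
  have hle : ∫ ω in A, (α - ‖φ ω‖) ∂μ ≤ 0 := by
    rw [integral_sub (integrable_const _) hint]
    have := h A hopen.measurableSet
    simpa [mul_comm] using this
  have hnull : μ A = 0 := by
    by_contra hne
    refine hle.not_gt ((setIntegral_pos_iff_support_of_nonneg_ae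
      ((ae_restrict_iff' hopen.measurableSet).2 (Eventually.of_forall fun ω hω => ?_))
      ((integrable_const _).sub hint)).2 ?_)
    · exact sub_nonneg.2 (le_of_lt hω)
    · refine (pos_iff_ne_zero.2 hne).trans_le (measure_mono fun ω hω => ⟨?_, hω⟩)
      exact (sub_pos.2 hω).ne'
  have hcocompact : A ∈ cocompact Ω := by
    have := (ZeroAtInftyContinuousMapClass.zero_at_infty φ).norm
    rw [norm_zero] at this
    exact this.eventually_lt_const hα
  obtain ⟨K, hK, hKA⟩ := mem_cocompact.1 hcocompact
  refine hK.of_isClosed_subset Measure.isClosed_support ?_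
  refine (subset_compl_comm.1 (Measure.subset_compl_support_of_isOpen hopen hnull)).trans ?_
  exact compl_subset_comm.1 hKA

/-! ### First order condition -/

section FirstOrder

attribute [local instance] InnerProductSpace.complexToReal

variable {L : ℕ} {T : ℝ}

theorem intervalIntegrable_field (hT : 0 ≤ T) {p : ℝ≥0∞} [Fact (1 ≤ p)] (v : FieldSpace L p T) :
    IntervalIntegrable v volume 0 T :=
  (intervalIntegrable_iff_integrableOn_Ioc_of_le hT).2 ((Lp.memLp v).integrable Fact.out)

theorem memLp_of_continuousOn {g : ℝ → EuclideanSpace ℝ (Fin L)} (hg : ContinuousOn g (Icc 0 T))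
    (q : ℝ≥0∞) : MemLp g q (timeMeasure T) := by
  obtain ⟨C, hC⟩ := isCompact_Icc.exists_bound_of_continuousOn hg
  exact MemLp.of_bound
    ((hg.mono Ioc_subset_Icc_self).aestronglyMeasurable measurableSet_Ioc) C
    ((ae_restrict_iff' measurableSet_Ioc).2 (Eventually.of_forall fun t ht =>
      hC t (Ioc_subset_Icc_self ht)))

/-- The first order necessary optimality condition, tested with restrictions of the minimizer. -/
theorem exists_mul_totalVariation_le
    {Ω : Type*} [TopologicalSpace Ω] [T2Space Ω] [MeasurableSpace Ω] [BorelSpace Ω]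
    {U : Type*} [NormedAddCommGroup U] [InnerProductSpace ℝ U]
    {H : Type*} [NormedAddCommGroup H] [InnerProductSpace ℂ H] [CompleteSpace H]
    (hT : 0 ≤ T) {p q : ℝ≥0∞} [Fact (1 ≤ p)] [Fact (1 ≤ q)]
    (H₀ : H →ₗ.[ℂ] H) {Hc : Fin L → H →L[ℂ] H} (hHc : ∀ l, IsSelfAdjoint (Hc l))
    (ψ₀ : H) (O : H →L[ℝ] H) {α : ℝ} (hα : 0 ≤ α)
    {B : FiniteMassMeasure Ω U →L[ℝ] FieldSpace L p T}
    {Bstar : FieldSpace L q T →L[ℝ] ZeroAtInftyContinuousMap Ω U} (hB : IsPredual Bstar B)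
    {u : FiniteMassMeasure Ω U} (hu : IsLocalMin (reducedCost T H₀ Hc ψ₀ O α B) u) :
    ∃ φ : ZeroAtInftyContinuousMap Ω U, ∀ A, MeasurableSet A →
      α * u.totalVariation.real A ≤ ∫ ω in A, ‖φ ω‖ ∂u.totalVariation := by
  obtain ⟨g, hg, C, hC⟩ := exists_observable_gradient hT H₀ hHc ψ₀ O
    (intervalIntegrable_field hT (B u))
  -- The factor `1/2` is the one in the cost; `g` is the gradient of the form without it.
  have hgL : MemLp (fun t => (1 / 2 : ℝ) • g t) q (timeMeasure T) :=
    memLp_of_continuousOn (by fun_prop) q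
  refine ⟨Bstar hgL.toLp, fun A hA => ?_⟩
  refine le_trans ?_ (u.abs_pairing_restrict_le hA _)
  refine le_trans ?_ (neg_le_abs _)
  rw [hB]
  set z := u.restrict hA
  have hpair : ∫ t, inner ℝ ((MemLp.toLp _ hgL : FieldSpace L q T) t) (B z t) ∂(timeMeasure T) =
      1 / 2 * ∫ t in (0 : ℝ)..T, ⟪g t, B z t⟫ := by
    rw [intervalIntegral.integral_of_le hT, ← integral_const_mul]
    refine integral_congr_ae ?_
    filter_upwards [hgL.coeFn_toLp] with t ht
    rw [ht, real_inner_smul_left]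
  rw [hpair]
  set P := ∫ t in (0 : ℝ)..T, ⟪g t, B z t⟫
  set W := ∫ t in (0 : ℝ)..T, ‖B z t‖
  have hfield : ∀ ε : ℝ, ∀ᵐ t ∂(timeMeasure T), B (u - ε • z) t - B u t = -ε • B z t := by
    intro ε
    rw [map_sub, map_smul]
    filter_upwards [Lp.coeFn_sub (B u) (ε • B z), Lp.coeFn_smul ε (B z)] with t h1 h2
    rw [h1, Pi.sub_apply, h2, Pi.smul_apply]
    module
  have hP : ∀ ε : ℝ, ∫ t in (0 : ℝ)..T, ⟪g t, B (u - ε • z) t - B u t⟫ = -ε * P := by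
    intro ε
    rw [← intervalIntegral.integral_const_mul, intervalIntegral.integral_of_le hT,
      intervalIntegral.integral_of_le hT]
    refine integral_congr_ae ?_
    filter_upwards [hfield ε] with t ht
    rw [ht, real_inner_smul_right]
  have hW : ∀ ε : ℝ, ∫ t in (0 : ℝ)..T, ‖B (u - ε • z) t - B u t‖ = |ε| * W := by
    intro ε
    rw [← intervalIntegral.integral_const_mul, intervalIntegral.integral_of_le hT,
      intervalIntegral.integral_of_le hT]
    refine integral_congr_ae ?_
    filter_upwards [hfield ε] with t ht
    rw [ht, norm_smul, norm_neg, Real.norm_eq_abs]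
  have hlim : Tendsto (fun ε : ℝ => u - ε • z) (𝓝[>] 0) (𝓝 u) := by
    have : Continuous fun ε : ℝ => u - ε • z := by fun_prop
    simpa using (this.tendsto 0).mono_left nhdsWithin_le_nhds
  -- Local minimality at `u - ε • z`, divided by `ε`: the mass gain is bounded by the linear loss
  -- `-P/2` plus a remainder that vanishes with `ε`.
  have hsmall : ∀ᶠ ε : ℝ in 𝓝[>] 0,
      α * u.totalVariation.real A ≤ -(1 / 2 * P) + 1 / 2 * (C * W ^ 2) * ε := by
    filter_upwards [hlim.eventually hu, Ioo_mem_nhdsGT (zero_lt_one' ℝ)] with ε hmin hε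
    have h1 := (abs_le.1 (hC _ (intervalIntegrable_field hT (B (u - ε • z))))).2
    rw [hP, hW, abs_of_pos hε.1] at h1
    have h2 := mul_le_mul_of_nonneg_left (u.norm_sub_smul_restrict_le hA hε.2.le) hα
    simp only [reducedCost, cost, ← RCLike.re_eq_complex_re, ← real_inner_eq_re_inner ℂ] at hmin
    refine le_of_mul_le_mul_left ?_ hε.1
    change _ ≤ 1 / 2 * ⟪_, _⟫ + _ at hmin
    nlinarith
  have hright : Tendsto (fun ε : ℝ => -(1 / 2 * P) + 1 / 2 * (C * W ^ 2) * ε) (𝓝[>] 0)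
      (𝓝 (-(1 / 2 * P))) := by
    have : Continuous fun ε : ℝ => -(1 / 2 * P) + 1 / 2 * (C * W ^ 2) * ε := by fun_prop
    simpa using (this.tendsto 0).mono_left nhdsWithin_le_nhds
  exact ge_of_tendsto hright hsmall

end FirstOrder

end QuantumControl

theorem mainTheorem5
    {Ω : Type*} [TopologicalSpace Ω] [T2Space Ω] [LocallyCompactSpace Ω]
    [MeasurableSpace Ω] [BorelSpace Ω]
    {U : Type*} [NormedAddCommGroup U] [InnerProductSpace ℝ U] [CompleteSpace U]
    [TopologicalSpace.SeparableSpace U]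
    {H : Type*} [NormedAddCommGroup H] [InnerProductSpace ℂ H] [CompleteSpace H]
    {L : ℕ} {T : ℝ} (hT : 0 < T)
    {p q : ℝ≥0∞} [Fact (1 ≤ p)] [Fact (1 ≤ q)] (hp : 1 < p) (hpq : ENNReal.HolderConjugate p q)
    (H₀ : H →ₗ.[ℂ] H) (hH₀ : IsSelfAdjoint H₀)
    (Hc : Fin L → H →L[ℂ] H) (hHc : ∀ l, IsSelfAdjoint (Hc l))
    (ψ₀ : H) (O : H →L[ℝ] H) {α : ℝ} (hα : 0 < α)
    (B : QuantumControl.FiniteMassMeasure Ω U →L[ℝ] QuantumControl.FieldSpace L p T)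
    (Bstar : QuantumControl.FieldSpace L q T →L[ℝ] ZeroAtInftyContinuousMap Ω U)
    (hB : QuantumControl.IsPredual Bstar B)
    (ubar : QuantumControl.FiniteMassMeasure Ω U)
    (hubar : IsLocalMin (QuantumControl.reducedCost T H₀ Hc ψ₀ O α B) ubar) :
    IsCompact ubar.totalVariation.support := by
  obtain ⟨φ, hφ⟩ :=
    QuantumControl.exists_mul_totalVariation_le hT.le H₀ hHc ψ₀ O hα.le hB hubar
  exact QuantumControl.isCompact_support_of_forall_mul_le hα φ hφ
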